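/- A \emph{coarse space} is a set $X$ with a collection of subsets of $X\times X$ (the \emph{controlled sets}) that contains the diagonal and is closed under subsets, inverses, finite unions and compositions. For $E\subseteq X\times X$, $x\in X$ and $U\subseteq X$ write $E_x=\{y\in X\mid (y,x)\in E\}$ and $E_U=\bigcup_{x\in U}E_x$. The set $U$ is \emph{bounded} if $U\times U$ is controlled, and \emph{$E$-bounded} if $U\times U\subseteq E$. The space $X$ is \emph{connected} if $\{(x,y)\}$ is controlled for all $x,y\in X$. It has \emph{bounded geometry} if there is a symmetric controlled set $F$ such that for every controlled set $E$ there is an $N$ such that every $E_x$ can be covered by at most $N$ sets that are $F$-bounded. Let $\mu$ be a measure on $X$, on any $\sigma$-algebra that contains all singletons. A set $E\subseteq X\times X$ is \emph{measurable} if $E_U$ is measurable for every measurable $U\subseteq X$. Call $\mu$ \emph{admissible} if (a) it is uniformly bounded: for every controlled set $E$ there is a finite constant $C$ such that $\mu(U)\le C$ for every $E$-bounded measurable set $U$; and (b) a gordo set exists: there are a symmetric measurable controlled set $E$ and a constant $c>0$ such that $\mu(E_x)\ge c$ for all $x\in X$. Say that $X$ is \emph{amenable with respect to $\mu$} if for every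 measurable controlled set $E\subseteq X\times X$ and every $\epsilon>0$ there is a non-empty bounded measurable set $U\subseteq X$ such that $\mu(E_U)\le(1+\epsilon)\mu(U)$. Say that $X$ is \emph{amenable} if it is amenable with respect to some admissible measure. Two coarse spaces $X,Y$ are \emph{coarsely equivalent} if there are maps $f\colon X\to Y$ and $g\colon Y\to X$ such that $f\times f$ and $g\times g$ map controlled sets to controlled sets and the sets $\{(x,gf(x))\mid x\in X\}$ and $\{(y,fg(y))\mid y\in Y\}$ are controlled. \textbf{Corollary.} (1) Let $X$ be a connected coarse space of bounded geometry that is a union of countably many bounded sets, and let $\mu_1,\mu_2$ be admissible measures on $X$ (possibly on different $\sigma$-algebras). Then $X$ is amenable with respect to $\mu_1$ if and only if it is amenable with respect to $\mu_2$. (2) Let $X$ and $Y$ be coarsely equivalent connected coarse spaces of bounded geometry, each of which is a union of countably many bounded sets. Then $X$ is amenable if and only if $Y$ is amenable. -/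

import Mathlib

open MeasureTheory
open scoped NNReal ENNReal

/-- A coarse structure on a set `X`: a collection of subsets of `X × X`, the controlled sets.
`SetRel X X` is Mathlib's name for the type of subsets of `X × X`. -/
class CoarseSpace (X : Type*) where
  /-- The collection of controlled sets. -/
  controlled : Set (SetRel X X)
  diag_mem : {p : X × X | p.1 = p.2} ∈ controlled
  mem_of_subset : ∀ {E F : SetRel X X}, E ∈ controlled → F ⊆ E → F ∈ controlled
  inv_mem : ∀ {E : SetRel X X}, E ∈ controlled → E.inv ∈ controlled
  union_mem : ∀ {E F : SetRel X X}, E ∈ controlled → F ∈ controlled → E ∪ F ∈ controlled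
  comp_mem : ∀ {E F : SetRel X X}, E ∈ controlled → F ∈ controlled → E.comp F ∈ controlled

namespace CoarseSpace

/-- `E_U = {y | (y, x) ∈ E for some x ∈ U}`. -/
def thickening {X : Type*} (E : SetRel X X) (U : Set X) : Set X :=
  {y | ∃ x ∈ U, (y, x) ∈ E}

/-- `E_x = {y | (y, x) ∈ E}`. -/
def fiber {X : Type*} (E : SetRel X X) (x : X) : Set X :=
  {y | (y, x) ∈ E}

/-- `U` is `E`-bounded if `U × U ⊆ E`. -/
def IsBoundedBy {X : Type*} (E : SetRel X X) (U : Set X) : Prop :=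
  U ×ˢ U ⊆ E

/-- `U` is bounded if `U × U` is controlled. -/
def IsBdd {X : Type*} [CoarseSpace X] (U : Set X) : Prop :=
  (U ×ˢ U : Set (X × X)) ∈ controlled (X := X)

/-- A coarse space is connected if every single pair is a controlled set. -/
def IsConnected (X : Type*) [CoarseSpace X] : Prop :=
  ∀ x y : X, ({(x, y)} : Set (X × X)) ∈ controlled (X := X)

/-- The space is a union of countably many bounded sets. -/
def IsSigmaBounded (X : Type*) [CoarseSpace X] : Prop :=
  ∃ B : ℕ → Set X, (∀ n, IsBdd (B n)) ∧ ⋃ n, B n = Set.univ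

/-- `F` is covering: it is controlled and symmetric, and for every controlled `E` there is an `N`
such that every `E_x` is covered by at most `N` sets that are `F`-bounded (the empty set
is `F`-bounded, so families of exactly `N` sets suffice). -/
def IsCovering {X : Type*} [CoarseSpace X] (F : SetRel X X) : Prop :=
  F ∈ controlled (X := X) ∧ F.inv = F ∧
    ∀ E ∈ controlled (X := X), ∃ N : ℕ, ∀ x : X, ∃ V : Fin N → Set X,
      (∀ i, IsBoundedBy F (V i)) ∧ fiber E x ⊆ ⋃ i, V i

/-- Bounded geometry: there is a controlled covering set. -/
def HasBoundedGeometry (X : Type*) [CoarseSpace X] : Prop :=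
  ∃ F : SetRel X X, IsCovering F

/-- `f` is a coarse equivalence. -/
def IsCoarseEquivalence {X Y : Type*} [CoarseSpace X] [CoarseSpace Y] (f : X → Y) : Prop :=
  ∃ g : Y → X,
    (∀ E ∈ controlled (X := X), Prod.map f f '' E ∈ controlled (X := Y)) ∧
    (∀ F ∈ controlled (X := Y), Prod.map g g '' F ∈ controlled (X := X)) ∧
    Set.range (fun x : X => (x, g (f x))) ∈ controlled (X := X) ∧
    Set.range (fun y : Y => (y, f (g y))) ∈ controlled (X := Y)

/-- `X` and `Y` are coarsely equivalent. -/
def CoarselyEquivalent (X Y : Type*) [CoarseSpace X] [CoarseSpace Y] : Prop :=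
  ∃ f : X → Y, IsCoarseEquivalence f

/-- `E` is measurable (for the σ-algebra `m`): `E_U` is measurable for all measurable `U`. -/
def IsMeasurableRel {X : Type*} (m : MeasurableSpace X) (E : SetRel X X) : Prop :=
  ∀ U : Set X, MeasurableSet[m] U → MeasurableSet[m] (thickening E U)

/-- `μ` is uniformly bounded: for each controlled `E`, the measures of the `E`-bounded measurable
sets are bounded by a finite constant. -/
def IsUniformlyBounded {X : Type*} [CoarseSpace X] {m : MeasurableSpace X}
    (μ : Measure X) : Prop :=
  ∀ E ∈ controlled (X := X), ∃ C : ℝ≥0, ∀ U : Set X,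
    MeasurableSet U → IsBoundedBy E U → μ U ≤ C

/-- `E` is `μ`-gordo: a symmetric measurable controlled set such that `μ (E_x)` is bounded away
from zero, uniformly in `x`. -/
def IsGordo {X : Type*} [CoarseSpace X] {m : MeasurableSpace X}
    (μ : Measure X) (E : SetRel X X) : Prop :=
  E ∈ controlled (X := X) ∧ E.inv = E ∧ IsMeasurableRel m E ∧
    ∃ c : ℝ≥0, 0 < c ∧ ∀ x : X, (c : ℝ≥0∞) ≤ μ (fiber E x)

/-- The measures used on a coarse space: the σ-algebra is arbitrary except that it contains the
singletons, the measure is uniformly bounded, and a gordo set exists. -/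
structure IsAdmissible {X : Type*} [CoarseSpace X] {m : MeasurableSpace X}
    (μ : Measure X) : Prop where
  measurableSet_singleton : ∀ x : X, MeasurableSet ({x} : Set X)
  uniformlyBounded : IsUniformlyBounded μ
  exists_gordo : ∃ E : SetRel X X, IsGordo μ E

/-- Amenability with respect to the measure `μ`: for each measurable controlled set `E` and each
`ε > 0` there is a non-empty bounded measurable `U` with `μ (E_U) ≤ (1 + ε) μ U`. -/
def IsAmenableFor {X : Type*} [CoarseSpace X] {m : MeasurableSpace X}
    (μ : Measure X) : Prop :=
  ∀ E ∈ controlled (X := X), IsMeasurableRel m E → ∀ ε : ℝ≥0, 0 < ε →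
    ∃ U : Set X, U.Nonempty ∧ IsBdd U ∧ MeasurableSet U ∧
      μ (thickening E U) ≤ (1 + (ε : ℝ≥0∞)) * μ U

/-- The coarse space `X` is amenable: it is amenable with respect to some admissible measure,
on some σ-algebra. -/
def IsAmenable (X : Type*) [CoarseSpace X] : Prop :=
  ∃ (m : MeasurableSpace X) (μ : @Measure X m), IsAdmissible μ ∧ IsAmenableFor μ

end CoarseSpace

/-! Amenability with respect to `μ` can be read off a discrete net `Z` in a way that no longer
mentions `μ`: it holds exactly when `Z` is not expanding (`IsNet.isAmenableFor_iff`), and any net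
may be used. A gordo set yields a net (`IsGordo.exists_isNet`). Up to constants, `μ` near a finite
part of the net counts its points: uniform boundedness gives the upper bound
(`IsAdmissible.exists_measure_le`), the gordo set the lower one (`IsGordo.exists_le_measure`). The
constants are harmless because a failure of amenability iterates from the factor `1 + ε` to any
factor (`exists_expansion_of_not_isAmenableFor`). For a coarse equivalence, independence of the
measure allows replacing `μ` by counting on a net, whose pushforward is admissible and inherits
amenability. -/

namespace CoarseSpace

/-! ### Thickenings, measurable relations and bounded sets. -/

section Basic

variable {X : Type*}

theorem mem_thickening {E : SetRel X X} {U : Set X} {y : X} :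
    y ∈ thickening E U ↔ ∃ x ∈ U, (y, x) ∈ E := Iff.rfl

theorem mem_fiber {E : SetRel X X} {x y : X} : y ∈ fiber E x ↔ (y, x) ∈ E := Iff.rfl

theorem thickening_singleton (E : SetRel X X) (x : X) : thickening E {x} = fiber E x := by
  ext y; simp [mem_thickening, mem_fiber]

theorem thickening_comp (E F : SetRel X X) (U : Set X) :
    thickening (E.comp F) U = thickening E (thickening F U) := by
  ext y
  constructor
  · rintro ⟨x, hx, z, hyz, hzx⟩
    exact ⟨z, ⟨x, hx, hzx⟩, hyz⟩
  · rintro ⟨z, ⟨x, hx, hzx⟩, hyz⟩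
    exact ⟨x, hx, z, hyz, hzx⟩

theorem thickening_mono {E F : SetRel X X} {U V : Set X} (hE : E ⊆ F) (hU : U ⊆ V) :
    thickening E U ⊆ thickening F V :=
  fun _ ⟨x, hx, h⟩ => ⟨x, hU hx, hE h⟩

theorem thickening_eq_biUnion (E : SetRel X X) (U : Set X) :
    thickening E U = ⋃ x ∈ U, fiber E x := by
  ext y; simp [mem_thickening, mem_fiber]

theorem IsMeasurableRel.comp {m : MeasurableSpace X} {E F : SetRel X X}
    (hE : IsMeasurableRel m E) (hF : IsMeasurableRel m F) : IsMeasurableRel m (E.comp F) := by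
  intro U hU
  rw [thickening_comp]
  exact hE _ (hF _ hU)

theorem IsMeasurableRel.union_diag {m : MeasurableSpace X} {E : SetRel X X}
    (hE : IsMeasurableRel m E) :
    IsMeasurableRel m (E ∪ {p : X × X | p.1 = p.2} : Set (X × X)) := by
  intro U hU
  have : thickening (E ∪ {p : X × X | p.1 = p.2} : Set (X × X)) U = thickening E U ∪ U := by
    ext y
    constructor
    · rintro ⟨x, hx, h | h⟩
      · exact Or.inl ⟨x, hx, h⟩
      · have h' : y = x := h
        exact Or.inr (h' ▸ hx)
    · rintro (⟨x, hx, h⟩ | h)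
      · exact ⟨x, hx, Or.inl h⟩
      · exact ⟨y, h, Or.inr rfl⟩
  rw [this]
  exact (hE U hU).union hU

theorem isBoundedBy_fiber (E : SetRel X X) (x : X) :
    IsBoundedBy (E.comp E.inv) (fiber E x) := by
  rintro ⟨a, b⟩ ⟨ha, hb⟩
  exact ⟨x, ha, hb⟩

variable [CoarseSpace X]

theorem IsBdd.thickening {E : SetRel X X} {U : Set X} (hE : E ∈ controlled (X := X))
    (hU : IsBdd U) : IsBdd (thickening E U) := by
  refine mem_of_subset (comp_mem (comp_mem hE hU) (inv_mem hE)) ?_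
  rintro ⟨a, b⟩ ⟨⟨x, hx, hax⟩, ⟨y, hy, hby⟩⟩
  exact ⟨y, ⟨x, hax, hx, hy⟩, hby⟩

theorem IsConnected.isBdd_finset (hX : IsConnected X) (S : Finset X) : IsBdd (S : Set X) := by
  have key : ∀ P : Finset (X × X), (P : Set (X × X)) ∈ controlled (X := X) := by
    classical
    intro P
    induction P using Finset.induction_on with
    | empty => exact mem_of_subset diag_mem (by simp)
    | insert p P _ ih =>
      rw [Finset.coe_insert, Set.insert_eq]
      exact union_mem (hX p.1 p.2) ih
  refine mem_of_subset (key (S ×ˢ S)) ?_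
  rw [Finset.coe_product]

end Basic

/-- A net: a uniformly locally finite, coarsely dense subset. -/
structure IsNet {X : Type*} [CoarseSpace X] (Z : Set X) : Prop where
  locallyFinite : ∀ E ∈ controlled (X := X), ∃ N : ℕ, ∀ x : X, ∀ S : Finset X,
    (S : Set X) ⊆ fiber E x ∩ Z → S.card ≤ N
  dense : ∃ D ∈ controlled (X := X), ∀ x : X, ∃ z ∈ Z, (x, z) ∈ D

/-- Finite subsets of `Z` can be expanded by an arbitrarily large factor. -/
def IsExpanding {X : Type*} [CoarseSpace X] (Z : Set X) : Prop :=
  ∀ K : ℕ, ∃ E ∈ controlled (X := X), ∀ S : Finset X, S.Nonempty → (S : Set X) ⊆ Z →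
    ∃ T : Finset X, (T : Set X) ⊆ thickening E S ∩ Z ∧ K * S.card ≤ T.card

/-! ### Nets, and comparison of admissible measures with counting. -/

section Net

variable {X : Type*}

/-- The counting measure of a subset, on the σ-algebra of all subsets. -/
noncomputable def countOn (Z : Set X) : @Measure X ⊤ :=
  letI : MeasurableSpace X := ⊤
  Measure.count.restrict Z

theorem countOn_apply (Z U : Set X) : countOn Z U = (U ∩ Z).encard := by
  let _ : MeasurableSpace X := ⊤
  have : MeasurableSingletonClass X := ⟨fun _ => trivial⟩
  rw [countOn, Measure.restrict_apply (MeasurableSpace.measurableSet_top),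
    Measure.count_apply MeasurableSpace.measurableSet_top]

variable [CoarseSpace X]

theorem IsNet.finite_of_isBdd {Z : Set X} (hZ : IsNet Z) {U : Set X} (hU : IsBdd U) :
    (U ∩ Z).Finite := by
  by_contra h
  obtain ⟨N, hN⟩ := hZ.locallyFinite _ hU
  obtain ⟨x, hx⟩ := Set.Infinite.nonempty h
  obtain ⟨S, hS, hc⟩ := Set.Infinite.exists_subset_card_eq h (N + 1)
  have := hN x S fun y hy => ⟨⟨(hS hy).1, hx.1⟩, (hS hy).2⟩
  omega

theorem IsNet.countable {Z : Set X} (hZ : IsNet Z) (hX : IsSigmaBounded X) : Z.Countable := by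
  obtain ⟨B, hB, hU⟩ := hX
  have : Z = ⋃ n, (B n ∩ Z) := by rw [← Set.iUnion_inter, hU, Set.univ_inter]
  rw [this]
  exact Set.countable_iUnion fun n => (hZ.finite_of_isBdd (hB n)).countable

/-- A maximal family of pairwise disjoint gordo fibers works: maximality gives density at scale
`G.comp G`, while disjoint fibers of measure at least `c` inside a set of measure at most `C` number
at most `C / c`. -/
theorem IsGordo.exists_isNet {m : MeasurableSpace X} {μ : Measure X}
    (hμ : IsAdmissible μ) {G : SetRel X X} (hG : IsGordo μ G) :
    ∃ Z : Set X, IsNet Z ∧ ∀ x, ∃ z ∈ Z, (x, z) ∈ G.comp G := by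
  obtain ⟨hGc, hGs, hGm, c, hc, hcG⟩ := hG
  have hfib : ∀ x, MeasurableSet (fiber G x) := fun x => by
    rw [← thickening_singleton]
    exact hGm _ (hμ.measurableSet_singleton x)
  have hsymm : ∀ x y, (x, y) ∈ G → (y, x) ∈ G := fun x y h => by
    rw [← hGs]; exact h
  -- With all radii equal to `1`, the Vitali lemma just selects a maximal disjoint family.
  obtain ⟨Z, -, hdisj, hcov⟩ := Vitali.exists_disjoint_subfamily_covering_enlargement
    (fun x => fiber G x) Set.univ (fun _ => (1 : ℝ)) 2 (by norm_num) (by simp) 1 (by simp)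
    (fun x _ => by
      by_contra h
      rw [Set.not_nonempty_iff_eq_empty] at h
      have := hcG x
      rw [h, measure_empty] at this
      simp at this
      exact hc.ne' this)
  have hdense : ∀ x, ∃ z ∈ Z, (x, z) ∈ G.comp G := fun x => by
    obtain ⟨z, hz, ⟨y, hyx, hyz⟩, -⟩ := hcov x (Set.mem_univ x)
    exact ⟨z, hz, y, hsymm _ _ hyx, hyz⟩
  refine ⟨Z, ⟨fun E hE => ?_, G.comp G, comp_mem hGc hGc, hdense⟩, hdense⟩
  have hGE : G.comp E ∈ controlled (X := X) := comp_mem hGc hE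
  obtain ⟨C, hC⟩ := hμ.uniformlyBounded _ (comp_mem hGE (inv_mem hGE))
  refine ⟨⌈C / c⌉₊, fun x S hS => ?_⟩
  have h1 : μ (⋃ s ∈ S, fiber G s) ≤ C := by
    refine hC _ (Finset.measurableSet_biUnion _ fun s _ => hfib s) ?_
    refine (Set.prod_mono ?_ ?_).trans (isBoundedBy_fiber (G.comp E) x) <;>
    · intro y hy
      simp only [Set.mem_iUnion] at hy
      obtain ⟨s, hs, hys⟩ := hy
      exact ⟨s, hys, (hS hs).1⟩
  rw [measure_biUnion_finset (fun a ha b hb hab => hdisj (hS ha).2 (hS hb).2 hab)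
    (fun s _ => hfib s)] at h1
  have h2 : (S.card : ℝ≥0∞) * c ≤ C := by
    refine le_trans ?_ h1
    rw [← nsmul_eq_mul]
    exact Finset.card_nsmul_le_sum _ _ _ fun s _ => hcG s
  have h3 : (S.card : ℝ≥0) * c ≤ C := by exact_mod_cast h2
  have h4 : (S.card : ℝ≥0) ≤ C / c := (le_div_iff₀ hc).2 h3
  exact_mod_cast h4.trans (Nat.le_ceil _)

/-- Every controlled set is contained in a measurable controlled set. -/
theorem IsAdmissible.exists_measurable_superset {m : MeasurableSpace X} {μ : Measure X}
    (hμ : IsAdmissible μ) (hX : IsSigmaBounded X) {E : SetRel X X}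
    (hE : E ∈ controlled (X := X)) :
    ∃ E' ∈ controlled (X := X), IsMeasurableRel m E' ∧ E ⊆ E' := by
  obtain ⟨G, hG⟩ := hμ.exists_gordo
  obtain ⟨Z, hZ, hd⟩ := hG.exists_isNet hμ
  obtain ⟨hGc, hGs, hGm, -⟩ := hG
  have hsymm : ∀ x y, (x, y) ∈ G → (y, x) ∈ G := fun x y h => by
    rw [← hGs]; exact h
  have hsymm' : ∀ x y, (x, y) ∈ G.comp G → (y, x) ∈ G.comp G := by
    rintro x y ⟨w, h1, h2⟩
    exact ⟨w, hsymm _ _ h2, hsymm _ _ h1⟩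
  have hGG : G.comp G ∈ controlled (X := X) := comp_mem hGc hGc
  -- Transporting `E` to the countable net makes measurability automatic, since every thickening by
  -- `P` is countable; two steps of `G` on each side then recover `E`.
  let P : SetRel X X := ((G.comp G).comp E).comp (G.comp G) ∩ Z ×ˢ Z
  have hP : P ∈ controlled (X := X) :=
    mem_of_subset (comp_mem (comp_mem hGG hE) hGG) Set.inter_subset_left
  have hPm : IsMeasurableRel m P := by
    intro U _
    have : MeasurableSingletonClass X := ⟨hμ.measurableSet_singleton⟩
    refine ((hZ.countable hX).mono ?_).measurableSet
    rintro y ⟨x, -, h⟩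
    exact h.2.1
  refine ⟨((G.comp G).comp P).comp (G.comp G), comp_mem (comp_mem hGG hP) hGG,
    ((hGm.comp hGm).comp hPm).comp (hGm.comp hGm), ?_⟩
  rintro ⟨x, y⟩ hxy
  obtain ⟨z, hz, hxz⟩ := hd x
  obtain ⟨w, hw, hyw⟩ := hd y
  have hzw : (z, w) ∈ P := ⟨⟨y, ⟨x, hsymm' _ _ hxz, hxy⟩, hyw⟩, hz, hw⟩
  exact ⟨w, ⟨z, hxz, hzw⟩, hsymm' _ _ hyw⟩

/-- Sets that are close to a finite set `S` have measure at most a constant times `|S|`. -/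
theorem IsAdmissible.exists_measure_le {m : MeasurableSpace X} {μ : Measure X}
    (hμ : IsAdmissible μ) (hX : IsSigmaBounded X) {D : SetRel X X}
    (hD : D ∈ controlled (X := X)) :
    ∃ C : ℝ≥0, 0 < C ∧ ∀ S : Finset X, ∀ W ⊆ thickening D S, μ W ≤ C * S.card := by
  obtain ⟨D', hD', hm, hsub⟩ := hμ.exists_measurable_superset hX hD
  obtain ⟨C, hC⟩ := hμ.uniformlyBounded _ (comp_mem hD' (inv_mem hD'))
  -- The `+ 1` makes the constant positive, so that it can be cancelled later.
  refine ⟨C + 1, by positivity, fun S W hW => ?_⟩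
  have h1 : W ⊆ ⋃ s ∈ S, fiber D' s := by
    refine (hW.trans (thickening_mono hsub subset_rfl)).trans ?_
    rw [thickening_eq_biUnion]
    rfl
  calc μ W ≤ ∑ s ∈ S, μ (fiber D' s) := (measure_mono h1).trans (measure_biUnion_finset_le _ _)
    _ ≤ S.card • ((C + 1 : ℝ≥0) : ℝ≥0∞) := Finset.sum_le_card_nsmul _ _ _ fun s _ => by
        refine (hC _ ?_ (isBoundedBy_fiber D' s)).trans (by simp)
        rw [← thickening_singleton]
        exact hm _ (hμ.measurableSet_singleton s)
    _ = _ := by rw [nsmul_eq_mul, mul_comm]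

/-- The gordo thickening of a finite subset `S` of a net has measure at least a constant
times `|S|`. -/
theorem IsGordo.exists_le_measure {m : MeasurableSpace X} {μ : Measure X}
    (hμ : IsAdmissible μ) {G : SetRel X X} (hG : IsGordo μ G) {Z : Set X} (hZ : IsNet Z) :
    ∃ c : ℝ≥0, 0 < c ∧ ∀ S : Finset X, (S : Set X) ⊆ Z → c * S.card ≤ μ (thickening G S) := by
  classical
  obtain ⟨hGc, hGs, hGm, c, hc, hcG⟩ := hG
  have hfib : ∀ x, MeasurableSet (fiber G x) := fun x => by
    rw [← thickening_singleton]
    exact hGm _ (hμ.measurableSet_singleton x)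
  obtain ⟨N, hN⟩ := hZ.locallyFinite _ (inv_mem hGc)
  refine ⟨c / (N + 1), by positivity, fun S hS => ?_⟩
  have : MeasurableSingletonClass X := ⟨hμ.measurableSet_singleton⟩
  have hmeas : MeasurableSet (thickening G S) := hGm _ S.measurableSet
  -- The fibers over `S` may overlap, but local finiteness lets a point lie in at most `N` of them.
  have h1 : ∀ y, ∑ s ∈ S, (fiber G s).indicator (fun _ => (1 : ℝ≥0∞)) y ≤
      (thickening G S).indicator (fun _ => ((N + 1 : ℝ≥0) : ℝ≥0∞)) y := by
    intro y
    by_cases hy : y ∈ thickening G S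
    · rw [Set.indicator_of_mem hy]
      simp only [Set.indicator_apply]
      rw [Finset.sum_boole]
      have := hN y (S.filter fun s => y ∈ fiber G s) (by
        intro s hs
        simp only [Finset.coe_filter, Set.mem_ofPred_eq] at hs
        exact ⟨hs.2, hS hs.1⟩)
      exact_mod_cast this.trans (Nat.le_succ N)
    · rw [Set.indicator_of_notMem hy]
      have h0 : ∀ s ∈ S, (fiber G s).indicator (fun _ => (1 : ℝ≥0∞)) y = 0 := fun s hs =>
        Set.indicator_of_notMem (s := fiber G s) (fun h => hy ⟨s, hs, h⟩) _
      exact (Finset.sum_eq_zero h0).le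
  have h2 : (S.card : ℝ≥0∞) * c ≤ ((N + 1 : ℝ≥0) : ℝ≥0∞) * μ (thickening G S) := by
    calc (S.card : ℝ≥0∞) * c ≤ ∑ s ∈ S, μ (fiber G s) := by
          rw [← nsmul_eq_mul]
          exact Finset.card_nsmul_le_sum _ _ _ fun s _ => hcG s
      _ = ∫⁻ y, ∑ s ∈ S, (fiber G s).indicator (fun _ => (1 : ℝ≥0∞)) y ∂μ := by
          rw [lintegral_finsetSum _ fun s _ => measurable_const.indicator (hfib s)]
          simp [lintegral_indicator, hfib]
      _ ≤ ∫⁻ y, (thickening G S).indicator (fun _ => ((N + 1 : ℝ≥0) : ℝ≥0∞)) y ∂μ :=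
          lintegral_mono h1
      _ = _ := by rw [lintegral_indicator_const hmeas]
  have hN0 : (N + 1 : ℝ≥0) ≠ 0 := by positivity
  rw [ENNReal.coe_div hN0, mul_comm, ← mul_div_assoc]
  exact ENNReal.div_le_of_le_mul' h2

/-- If `X` is not amenable with respect to `μ`, then measures of bounded measurable sets can be
expanded by arbitrarily large factors. -/
theorem exists_expansion_of_not_isAmenableFor {m : MeasurableSpace X} {μ : Measure X}
    (h : ¬ IsAmenableFor μ) (K : ℝ≥0) :
    ∃ E ∈ controlled (X := X), IsMeasurableRel m E ∧
      ∀ U : Set X, U.Nonempty → IsBdd U → MeasurableSet U → K * μ U ≤ μ (thickening E U) := by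
  simp only [IsAmenableFor] at h
  push Not at h
  obtain ⟨E₀, hE₀, hm₀, ε, hε, h₀⟩ := h
  -- With the diagonal added, thickening never loses points, so nonemptiness survives the iteration.
  let E : SetRel X X := (E₀ ∪ {p : X × X | p.1 = p.2} : Set (X × X))
  have hE : E ∈ controlled (X := X) := union_mem hE₀ diag_mem
  have hm : IsMeasurableRel m E := hm₀.union_diag
  have hsub : ∀ U, U ⊆ thickening E U := fun U x hx => ⟨x, hx, Or.inr rfl⟩
  have hexp : ∀ U : Set X, U.Nonempty → IsBdd U → MeasurableSet U →
      (1 + ε : ℝ≥0∞) * μ U ≤ μ (thickening E U) := fun U h1 h2 h3 =>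
    (h₀ U h1 h2 h3).le.trans (measure_mono (thickening_mono Set.subset_union_left subset_rfl))
  have hiter : ∀ n : ℕ, ∃ F ∈ controlled (X := X), IsMeasurableRel m F ∧
      ∀ U : Set X, U.Nonempty → IsBdd U → MeasurableSet U →
        (thickening F U).Nonempty ∧ (1 + ε : ℝ≥0∞) ^ n * μ U ≤ μ (thickening F U) := by
    intro n
    induction n with
    | zero =>
      refine ⟨E, hE, hm, fun U h1 _ _ => ⟨h1.mono (hsub U), ?_⟩⟩
      simpa using measure_mono (hsub U)
    | succ n ih =>
      obtain ⟨F, hF, hFm, hFe⟩ := ih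
      refine ⟨E.comp F, comp_mem hE hF, hm.comp hFm, fun U h1 h2 h3 => ?_⟩
      obtain ⟨hne, hle⟩ := hFe U h1 h2 h3
      rw [thickening_comp]
      refine ⟨hne.mono (hsub _), ?_⟩
      calc (1 + ε : ℝ≥0∞) ^ (n + 1) * μ U = (1 + ε) * ((1 + ε) ^ n * μ U) := by
            rw [pow_succ']; ring
        _ ≤ (1 + ε) * μ (thickening F U) := by gcongr
        _ ≤ _ := hexp _ hne (h2.thickening hF) (hFm U h3)
  obtain ⟨n, hn⟩ := pow_unbounded_of_one_lt K (show (1 : ℝ≥0) < 1 + ε by simpa using hε)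
  obtain ⟨F, hF, hFm, hFe⟩ := hiter n
  refine ⟨F, hF, hFm, fun U h1 h2 h3 => le_trans ?_ (hFe U h1 h2 h3).2⟩
  gcongr
  exact_mod_cast hn.le

/-- Thicken `S` by `G`, expand in measure, and return to the net points near the result. The factor
`K * C / c` absorbs the losses `c` and `C` of the two passages. -/
theorem IsNet.isExpanding_of_not_isAmenableFor {m : MeasurableSpace X} {μ : Measure X}
    (hμ : IsAdmissible μ) (hconn : IsConnected X) (hX : IsSigmaBounded X) {Z : Set X}
    (hZ : IsNet Z) (h : ¬ IsAmenableFor μ) : IsExpanding Z := by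
  intro K
  obtain ⟨G, hG⟩ := hμ.exists_gordo
  obtain ⟨c, hc, hcS⟩ := hG.exists_le_measure hμ hZ
  obtain ⟨D, hD, hdense⟩ := hZ.dense
  obtain ⟨C, hC, hCS⟩ := hμ.exists_measure_le hX hD
  obtain ⟨E, hE, hEm, hexp⟩ := exists_expansion_of_not_isAmenableFor h (K * C / c)
  obtain ⟨hGc, hGs, hGm, c', hc', hcG⟩ := hG
  have : MeasurableSingletonClass X := ⟨hμ.measurableSet_singleton⟩
  refine ⟨D.inv.comp (E.comp G), comp_mem (inv_mem hD) (comp_mem hE hGc), fun S hS hSZ => ?_⟩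
  have hbdd := hconn.isBdd_finset S
  rw [thickening_comp, thickening_comp]
  set W := thickening E (thickening G S) with hW
  have hWb : IsBdd W := (hbdd.thickening hGc).thickening hE
  have hfin : (thickening D.inv W ∩ Z).Finite :=
    hZ.finite_of_isBdd (hWb.thickening (inv_mem hD))
  refine ⟨hfin.toFinset, by simp, ?_⟩
  have hne : (thickening G (S : Set X)).Nonempty := by
    rw [Set.nonempty_iff_ne_empty]
    intro h0
    have h1 := hcS S hSZ
    rw [h0, measure_empty, nonpos_iff_eq_zero, mul_eq_zero] at h1
    rcases h1 with h1 | h1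
    · exact hc.ne' (by exact_mod_cast h1)
    · exact hS.card_pos.ne' (by exact_mod_cast h1)
  have h1 := hexp _ hne (hbdd.thickening hGc) (hGm _ S.measurableSet)
  have h2 : μ W ≤ C * hfin.toFinset.card := by
    refine hCS _ _ fun w hw => ?_
    obtain ⟨z, hz, hwz⟩ := hdense w
    exact ⟨z, by simpa using ⟨⟨w, hw, hwz⟩, hz⟩, hwz⟩
  have h3 : ((K * C / c : ℝ≥0) : ℝ≥0∞) * (c * S.card) ≤ C * hfin.toFinset.card :=
    (mul_le_mul_right (hcS S hSZ) _).trans (h1.trans h2)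
  have h4 : (K * C / c : ℝ≥0) * (c * S.card) ≤ C * hfin.toFinset.card := by exact_mod_cast h3
  have h5 : C * (K * S.card : ℝ≥0) ≤ C * hfin.toFinset.card := by
    calc C * (K * S.card : ℝ≥0) = (K * C / c : ℝ≥0) * (c * S.card) := by
          field_simp
      _ ≤ _ := h4
  exact_mod_cast le_of_mul_le_mul_left h5 hC

/-- For a test set `U` with `ε = 1`, let `S` be the net points near `U` and `T` its expansion. Then
`c * |T| ≤ μ (L_U) ≤ 2 * μ U ≤ 2 * C * |S|`, against `K * |S| ≤ |T|` with `K > 2 * C / c`. -/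
theorem IsExpanding.not_isAmenableFor {m : MeasurableSpace X} {μ : Measure X}
    (hμ : IsAdmissible μ) (hX : IsSigmaBounded X) {Z : Set X}
    (hZ : IsNet Z) (h : IsExpanding Z) : ¬ IsAmenableFor μ := by
  intro ham
  obtain ⟨G, hG⟩ := hμ.exists_gordo
  obtain ⟨c, hc, hcS⟩ := hG.exists_le_measure hμ hZ
  obtain ⟨D, hD, hdense⟩ := hZ.dense
  obtain ⟨C, hC, hCS⟩ := hμ.exists_measure_le hX hD
  obtain ⟨K, hK⟩ := exists_nat_gt (2 * C / c)
  obtain ⟨E, hE, hexp⟩ := h K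
  have hGc := hG.1
  -- `L` covers the whole route: from `U` to the net, through the expansion, then a gordo
  -- thickening.
  obtain ⟨L, hL, hLm, hsub⟩ := hμ.exists_measurable_superset hX
    (comp_mem hGc (comp_mem hE (inv_mem hD)))
  obtain ⟨U, hUne, hUb, hUm, hU⟩ := ham L hL hLm 1 one_pos
  have hfin : (thickening D.inv U ∩ Z).Finite :=
    hZ.finite_of_isBdd (hUb.thickening (inv_mem hD))
  set S := hfin.toFinset with hS
  have hSne : S.Nonempty := by
    obtain ⟨u, hu⟩ := hUne
    obtain ⟨z, hz, huz⟩ := hdense u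
    exact ⟨z, by simpa [hS] using ⟨⟨u, hu, huz⟩, hz⟩⟩
  obtain ⟨T, hT, hcard⟩ := hexp S hSne (by simp [hS])
  have h1 : μ U ≤ C * S.card := by
    refine hCS _ _ fun w hw => ?_
    obtain ⟨z, hz, hwz⟩ := hdense w
    exact ⟨z, by simpa [hS] using ⟨⟨w, hw, hwz⟩, hz⟩, hwz⟩
  have h2 : c * T.card ≤ μ (thickening L U) := by
    refine (hcS T fun t ht => (hT ht).2).trans (measure_mono ?_)
    refine subset_trans ?_ (thickening_mono hsub subset_rfl)
    rw [thickening_comp, thickening_comp]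
    refine thickening_mono subset_rfl fun t ht => ?_
    exact thickening_mono subset_rfl (by simp [hS]) (hT ht).1
  have h3 : (c : ℝ≥0∞) * T.card ≤ (1 + (1 : ℝ≥0)) * (C * S.card) :=
    h2.trans (hU.trans (by gcongr))
  have h4 : c * T.card ≤ (1 + 1) * (C * S.card) := by exact_mod_cast h3
  have h5 : (K * S.card : ℝ≥0) ≤ T.card := by exact_mod_cast hcard
  have h6 : 2 * C < c * K := by
    rw [div_lt_iff₀ hc] at hK
    rwa [mul_comm c]
  have hpos : (0 : ℝ≥0) < S.card := by exact_mod_cast hSne.card_pos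
  have h7 : 2 * C * S.card < c * K * S.card := mul_lt_mul_of_pos_right h6 hpos
  have h8 : c * K * S.card ≤ c * T.card := by
    rw [mul_assoc]; gcongr
  refine absurd (h7.trans_le (h8.trans h4)) (not_lt.2 (le_of_eq ?_))
  ring

theorem IsNet.isAmenableFor_iff {m : MeasurableSpace X} {μ : Measure X}
    (hμ : IsAdmissible μ) (hconn : IsConnected X) (hX : IsSigmaBounded X) {Z : Set X}
    (hZ : IsNet Z) : IsAmenableFor μ ↔ ¬ IsExpanding Z :=
  ⟨fun h h' => h'.not_isAmenableFor hμ hX hZ h,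
    fun h => by_contra fun h' => h (hZ.isExpanding_of_not_isAmenableFor hμ hconn hX h')⟩

theorem isAmenableFor_iff_of_isAdmissible (hconn : IsConnected X) (hX : IsSigmaBounded X)
    {m₁ m₂ : MeasurableSpace X} {μ₁ : @Measure X m₁} {μ₂ : @Measure X m₂}
    (h₁ : IsAdmissible μ₁) (h₂ : IsAdmissible μ₂) : IsAmenableFor μ₁ ↔ IsAmenableFor μ₂ := by
  obtain ⟨G, hG⟩ := h₁.exists_gordo
  obtain ⟨Z, hZ, -⟩ := hG.exists_isNet h₁
  rw [hZ.isAmenableFor_iff h₁ hconn hX, hZ.isAmenableFor_iff h₂ hconn hX]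

/-- Local finiteness is uniform boundedness of the counting measure; density provides a gordo set
with `c = 1`. -/
theorem IsNet.isAdmissible_countOn {Z : Set X} (hZ : IsNet Z) : IsAdmissible (countOn Z) := by
  let _ : MeasurableSpace X := ⊤
  refine ⟨fun _ => trivial, fun E hE => ?_, ?_⟩
  · obtain ⟨N, hN⟩ := hZ.locallyFinite E hE
    refine ⟨N, fun U _ hU => ?_⟩
    rw [countOn_apply]
    rcases (U ∩ Z).eq_empty_or_nonempty with h | ⟨x, hx⟩
    · simp [h]
    have hsub : U ∩ Z ⊆ fiber E x ∩ Z := fun y hy => ⟨hU ⟨hy.1, hx.1⟩, hy.2⟩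
    have hfin : (U ∩ Z).Finite := by
      by_contra h
      obtain ⟨S, hS, hc⟩ := Set.Infinite.exists_subset_card_eq h (N + 1)
      have := hN x S (hS.trans hsub)
      omega
    have := hN x hfin.toFinset (by simpa using hsub)
    rw [hfin.encard_eq_coe_toFinset_card, ENat.toENNReal_coe, ENNReal.coe_natCast]
    exact Nat.cast_le.2 this
  · obtain ⟨D, hD, hd⟩ := hZ.dense
    refine ⟨(D ∪ D.inv : Set (X × X)), union_mem hD (inv_mem hD), ?_, fun _ _ => trivial,
      1, one_pos, fun x => ?_⟩
    · ext ⟨a, b⟩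
      exact or_comm
    · obtain ⟨z, hz, hxz⟩ := hd x
      rw [countOn_apply]
      have : (1 : ℕ∞) ≤ (fiber (D ∪ D.inv : Set (X × X)) x ∩ Z).encard := by
        rw [Set.one_le_encard_iff_nonempty]
        exact ⟨z, Or.inr hxz, hz⟩
      simpa using ENat.toENNReal_le.2 this

end Net

/-! ### Invariance under coarse equivalence. -/

section CoarseEquivalence

variable {X Y : Type*} [CoarseSpace X] [CoarseSpace Y]

/-- If `(f a, f b) ∈ E`, then `a` is near `g (f a)`, which is near `g (f b)`, which is near `b`. -/
theorem IsCoarseEquivalence.preimage_mem {f : X → Y} (hf : IsCoarseEquivalence f)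
    {E : SetRel Y Y} (hE : E ∈ controlled (X := Y)) :
    (Prod.map f f ⁻¹' E : Set (X × X)) ∈ controlled (X := X) := by
  obtain ⟨g, -, hg, hgf, -⟩ := hf
  refine mem_of_subset (comp_mem (comp_mem hgf (hg E hE)) (inv_mem hgf)) ?_
  rintro ⟨a, b⟩ hab
  exact ⟨g (f b), ⟨g (f a), ⟨a, rfl⟩, ⟨(f a, f b), hab, rfl⟩⟩, ⟨b, rfl⟩⟩

theorem CoarselyEquivalent.symm (h : CoarselyEquivalent X Y) : CoarselyEquivalent Y X := by
  obtain ⟨f, g, hf, hg, hgf, hfg⟩ := h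
  exact ⟨g, f, hg, hf, hfg, hgf⟩

/-- Counting on a net lives on the σ-algebra of all subsets, so it can be pushed forward along `f`
with no measurability condition. -/
theorem IsAmenable.of_coarselyEquivalent (hconn : IsConnected X) (hX : IsSigmaBounded X)
    (h : CoarselyEquivalent X Y) (ham : IsAmenable X) : IsAmenable Y := by
  obtain ⟨m, μ, hμ, hμa⟩ := ham
  obtain ⟨G, hG⟩ := hμ.exists_gordo
  obtain ⟨Z, hZ, -⟩ := hG.exists_isNet hμ
  have hν := hZ.isAdmissible_countOn
  rw [isAmenableFor_iff_of_isAdmissible hconn hX hμ hν] at hμa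
  obtain ⟨f, hf⟩ := h
  let _ : MeasurableSpace X := ⊤
  let _ : MeasurableSpace Y := ⊤
  have hmf : Measurable f := fun _ _ => trivial
  have hmap : ∀ V : Set Y, (countOn Z).map f V = countOn Z (f ⁻¹' V) := fun V =>
    Measure.map_apply hmf trivial
  refine ⟨⊤, (countOn Z).map f, ⟨fun _ => trivial, fun E hE => ?_, ?_⟩, ?_⟩
  · obtain ⟨C, hC⟩ := hν.uniformlyBounded _ (hf.preimage_mem hE)
    refine ⟨C, fun V _ hV => ?_⟩
    rw [hmap]
    exact hC _ trivial fun p hp => hV ⟨hp.1, hp.2⟩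
  · obtain ⟨D, hD, -, -, c, hc, hcD⟩ := hν.exists_gordo
    obtain ⟨g, hfc, hgc, -, hfg⟩ := hf
    -- For `x` in the `D`-fiber of `g y`, the point `f x` is near `f (g y)`, hence near `y`; so the
    -- preimage of the `E`-fiber of `y` contains that `D`-fiber.
    let E : SetRel Y Y := SetRel.comp (Prod.map f f '' D : Set (Y × Y))
      (SetRel.inv (Set.range fun y : Y => (y, f (g y))))
    have hE : E ∈ controlled (X := Y) := comp_mem (hfc D hD) (inv_mem hfg)
    refine ⟨(E ∪ E.inv : Set (Y × Y)), union_mem hE (inv_mem hE), ?_, fun _ _ => trivial,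
      c, hc, fun y => ?_⟩
    · ext ⟨a, b⟩
      exact or_comm
    · rw [hmap]
      refine (hcD (g y)).trans (measure_mono fun x hx => ?_)
      exact Or.inl ⟨f (g y), ⟨(x, g y), hx, rfl⟩, ⟨y, rfl⟩⟩
  · intro E hE _ ε hε
    obtain ⟨U, hne, hb, -, hU⟩ := hμa _ (hf.preimage_mem hE) (fun _ _ => trivial) ε hε
    refine ⟨f '' U, hne.image f, ?_, trivial, ?_⟩
    · obtain ⟨g, hfc, -⟩ := hf
      refine mem_of_subset (hfc _ hb) ?_
      rintro ⟨_, _⟩ ⟨⟨a, ha, rfl⟩, ⟨b, hb, rfl⟩⟩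
      exact ⟨(a, b), ⟨ha, hb⟩, rfl⟩
    · rw [hmap, hmap]
      -- Pulling back turns the thickening of `f '' U` into one of `U`, while `f ⁻¹' (f '' U)` can
      -- only be larger than `U`; both favour the inequality.
      have hpre : f ⁻¹' thickening E (f '' U) =
          thickening (Prod.map f f ⁻¹' E : Set (X × X)) U := by
        ext x
        constructor
        · rintro ⟨_, ⟨u, hu, rfl⟩, h⟩
          exact ⟨u, hu, h⟩
        · rintro ⟨u, hu, h⟩
          exact ⟨f u, ⟨u, hu, rfl⟩, h⟩
      rw [hpre]
      exact hU.trans (mul_le_mul_right (measure_mono (Set.subset_preimage_image f U)) _)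

end CoarseEquivalence

end CoarseSpace

theorem mainTheorem10 :
    -- amenability does not depend on the measure (nor on its σ-algebra)
    (∀ (X : Type*) [CoarseSpace X],
      CoarseSpace.IsConnected X → CoarseSpace.HasBoundedGeometry X →
      CoarseSpace.IsSigmaBounded X →
      ∀ (m₁ m₂ : MeasurableSpace X) (μ₁ : @MeasureTheory.Measure X m₁)
        (μ₂ : @MeasureTheory.Measure X m₂),
        CoarseSpace.IsAdmissible μ₁ → CoarseSpace.IsAdmissible μ₂ →
        (CoarseSpace.IsAmenableFor μ₁ ↔ CoarseSpace.IsAmenableFor μ₂)) ∧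
    -- amenability is invariant under coarse equivalence
    (∀ (X : Type*) (Y : Type*) [CoarseSpace X] [CoarseSpace Y],
      CoarseSpace.IsConnected X → CoarseSpace.HasBoundedGeometry X →
      CoarseSpace.IsSigmaBounded X →
      CoarseSpace.IsConnected Y → CoarseSpace.HasBoundedGeometry Y →
      CoarseSpace.IsSigmaBounded Y →
      CoarseSpace.CoarselyEquivalent X Y →
      (CoarseSpace.IsAmenable X ↔ CoarseSpace.IsAmenable Y)) := by
  refine ⟨fun X _ hconn _ hX m₁ m₂ μ₁ μ₂ h₁ h₂ =>
    CoarseSpace.isAmenableFor_iff_of_isAdmissible hconn hX h₁ h₂, ?_⟩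
  intro X Y _ _ hconnX _ hX hconnY _ hY h
  exact ⟨CoarseSpace.IsAmenable.of_coarselyEquivalent hconnX hX h,
    CoarseSpace.IsAmenable.of_coarselyEquivalent hconnY hY h.symm⟩
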